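/- Trail Trap is the following two-player game on a finite simple graph $G$. Player 1 (P1) chooses a starting vertex for their token and moves the token along an incident edge to the other endpoint of that edge; then Player 2 (P2) chooses any starting vertex for their own token and moves it along an incident edge different from the one used by P1. From then on the players alternate, starting with P1, each moving their own token from its current vertex along an edge that has not been used before by either player, in either direction, to the adjacent vertex. Vertices may be revisited and both tokens may occupy the same vertex. The first player unable to move on their turn (including their first turn) loses. The graph $G$ is called P1-win (respectively P2-win) if P1 (respectively P2) has a winning strategy. Theorem. Let $K_{p,q}$ denote the complete bipartite graph with parts of sizes $p$ and $q$. 1. If at least one of $p,q$ is even, then $K_{p,q}$ is P2-win. 2. If $q\ge 5$ is odd, then $K_{3,q}$ is P1-win. -/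

import Mathlib

namespace TrailTrap

/-- The two players; `one` moves first. -/
inductive Player
  | one
  | two

variable {V : Type*}

/-- A partial game of Trail Trap on `G`: the chronological list of the moves made so far (players
alternate, `one` starts). A move `(u, v)` takes a token from `u` along the edge `uv` to `v`. Every
move runs along an edge of `G`, no edge is used twice (by either player, in either direction), and
each move of a player starts where that player's previous move ended; the starting vertex of each
player's first move is free. -/
structure IsPartialGame (G : SimpleGraph V) (S : List (V × V)) : Prop where
  adj : ∀ m ∈ S, G.Adj m.1 m.2
  edges_nodup : (S.map fun m => s(m.1, m.2)).Nodup
  head_eq_tail : ∀ (i : ℕ) (h : i + 2 < S.length), (S[i]'(by omega)).2 = (S[i + 2]'h).1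

/-- The player whose turn it is after the moves `S`. -/
def toMove (S : List (V × V)) : Player :=
  if Even S.length then .one else .two

/-- After the moves `S`, the player whose turn it is has no legal move. -/
def IsOver (G : SimpleGraph V) (S : List (V × V)) : Prop :=
  ∀ m : V × V, ¬ IsPartialGame G (S ++ [m])

/-- A (deterministic) strategy: given the moves so far, it names the move to make, if any. -/
abbrev Strategy (V : Type*) := List (V × V) → Option (V × V)

/-- In `S`, all moves of player `P` are those prescribed by `σ`. -/
def Follows (P : Player) (σ : Strategy V) (S : List (V × V)) : Prop :=
  ∀ (i : ℕ) (h : i < S.length), toMove (S.take i) = P → σ (S.take i) = some (S[i]'h)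

/-- `σ` is a winning strategy for player `P` on the finite graph `G`: in every partial game in which
`P` has followed `σ`, if it is `P`'s turn and the game is not over, then `σ` prescribes a legal move;
and whenever a game in which `P` has followed `σ` is over, it is the other player who is unable to
move. (Every game ends, since no edge is used twice and `G` is finite.) -/
structure IsWinningStrategy [Finite V] (G : SimpleGraph V) (P : Player) (σ : Strategy V) :
    Prop where
  legal : ∀ S, IsPartialGame G S → Follows P σ S → toMove S = P → ¬ IsOver G S →
    ∃ m, σ S = some m ∧ IsPartialGame G (S ++ [m])
  wins : ∀ S, IsPartialGame G S → Follows P σ S → IsOver G S → toMove S ≠ P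

/-- Player 1 has a winning strategy in Trail Trap on `G`. -/
def P1Win [Finite V] (G : SimpleGraph V) : Prop :=
  ∃ σ : Strategy V, IsWinningStrategy G .one σ

/-- Player 2 has a winning strategy in Trail Trap on `G`. -/
def P2Win [Finite V] (G : SimpleGraph V) : Prop :=
  ∃ σ : Strategy V, IsWinningStrategy G .two σ

end TrailTrap

/-!
If one part is even, reversing the order of its vertices is an involutive automorphism of the
graph without a fixed edge. The second player wins by playing the image of each move of the first
player (`p2Win_of_involutive`): an unused edge and its image are distinct and both unused.

On `K_{3,q}` the first player moves from a left vertex to a right one. A right vertex has three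
edges, so a token passing through a fresh one (all edges unused) leaves a single unused edge
there, and entering a vertex along its last unused edge means being stuck on the next turn. The
first player therefore enters fresh vertices as long as there are any, and the second player has
to do the same: if the second player takes a last edge, any legal reply wins.

If the second player starts in the left part, both tokens are always in the same part when the
first player is to move, and the first player wins because the number of fresh vertices is odd
(`posWin_in_phase`).

If the second player starts in the right part, at a vertex which after that has two unused edges,
the first player passes through this vertex too (or, if the second player does so, gains the same
tempo) and so makes the number of fresh vertices even when the second player is to leave the left
part; if that vertex is the one the first player is at, the number is even anyway. Then the fresh
vertices run out when the second player is to move, with both tokens in the left part. Either the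
second player is stuck, or takes a last edge, and then the first player needs one last edge as
well (`good_zero`). Each passage through a fresh vertex from `i` to `j` leaves an unused edge at
the third left vertex, so the first player can collect such edges at some `j` and end there
(`good_of_two_le`, `good_of_enough`). From the opening positions this is reached after a few
rounds (`good_start_same`, `good_start_fresh`), and the finitely many ways in which these rounds
can be played are checked by `decide`.
-/

/-! ### Winning strategies from invariants -/

namespace TrailTrap

section General

variable {V : Type*} {G : SimpleGraph V}

theorem isPartialGame_nil : IsPartialGame G [] :=
  ⟨by simp, by simp, by simp⟩

theorem isPartialGame_append_singleton (S : List (V × V)) (m : V × V) :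
    IsPartialGame G (S ++ [m]) ↔ IsPartialGame G S ∧ G.Adj m.1 m.2 ∧
      s(m.1, m.2) ∉ S.map (fun m => s(m.1, m.2)) ∧
      ∀ (i : ℕ) (h : i + 2 = S.length), (S[i]'(by omega)).2 = m.1 := by
  constructor
  · rintro ⟨h1, h2, h3⟩
    rw [List.map_append, List.nodup_append] at h2
    refine ⟨⟨fun m hm => h1 m (by simp [hm]), h2.1, fun i h => ?_⟩, h1 m (by simp), ?_, ?_⟩
    · have := h3 i (by simp; omega)
      rwa [List.getElem_append_left (by omega), List.getElem_append_left h] at this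
    · intro hm
      exact h2.2.2 _ hm _ (by simp) rfl
    · intro i h
      have := h3 i (by simp; omega)
      rwa [List.getElem_append_left (by omega), List.getElem_append_right (by omega),
        List.getElem_singleton] at this
  · rintro ⟨⟨h1, h2, h3⟩, h4, h5, h6⟩
    refine ⟨?_, ?_, fun i h => ?_⟩
    · intro a ha
      rcases List.mem_append.1 ha with ha | ha
      · exact h1 a ha
      · rw [List.mem_singleton.1 ha]; exact h4
    · rw [List.map_append, List.nodup_append]
      refine ⟨h2, by simp, fun a ha b hb hab => h5 ?_⟩
      simp only [List.map_cons, List.map_nil, List.mem_singleton] at hb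
      rwa [← hb, ← hab]
    · rcases Nat.lt_or_ge (i + 2) S.length with hi | hi
      · rw [List.getElem_append_left (by omega), List.getElem_append_left hi]
        exact h3 i hi
      · have hi' : i + 2 = S.length := by simp at h; omega
        rw [List.getElem_append_left (by omega), List.getElem_append_right (by omega),
          List.getElem_singleton]
        exact h6 i hi'

theorem isPartialGame_singleton (m : V × V) : IsPartialGame G [m] ↔ G.Adj m.1 m.2 := by
  have := isPartialGame_append_singleton (G := G) [] m
  simpa [isPartialGame_nil] using this

theorem isPartialGame_pair (m m' : V × V) : IsPartialGame G [m, m'] ↔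
    G.Adj m.1 m.2 ∧ G.Adj m'.1 m'.2 ∧ s(m'.1, m'.2) ≠ s(m.1, m.2) := by
  have := isPartialGame_append_singleton (G := G) [m] m'
  simpa [isPartialGame_singleton] using this

/-- Once both players have moved, the next mover continues from the end of the last but one move. -/
theorem isPartialGame_append_pair_append (S : List (V × V)) (a b m : V × V) :
    IsPartialGame G (S ++ [a, b] ++ [m]) ↔ IsPartialGame G (S ++ [a, b]) ∧ G.Adj m.1 m.2 ∧
      s(m.1, m.2) ∉ (S ++ [a, b]).map (fun m => s(m.1, m.2)) ∧ a.2 = m.1 := by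
  rw [isPartialGame_append_singleton]
  refine and_congr_right fun _ => and_congr_right fun _ => and_congr_right fun _ => ?_
  constructor
  · intro h
    have := h S.length (by simp)
    simpa [List.getElem_append_right] using this
  · intro h i hi
    obtain rfl : i = S.length := by simpa using hi
    simpa [List.getElem_append_right] using h

theorem toMove_append_singleton (S : List (V × V)) (m : V × V) (P : Player) :
    toMove (S ++ [m]) = P ↔ toMove S ≠ P := by
  cases P <;> simp [toMove, Nat.even_add_one]

/-- A property of partial games that `P` can always restore by a legal move, and that no legal move
of the opponent destroys, yields a winning strategy for `P`: with it `P` is never stuck. -/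
theorem exists_isWinningStrategy [Finite V] {P : Player} (I : List (V × V) → Prop) (h0 : I [])
    (hown : ∀ S, IsPartialGame G S → I S → toMove S = P →
      ∃ m, IsPartialGame G (S ++ [m]) ∧ I (S ++ [m]))
    (hopp : ∀ S m, I S → toMove S ≠ P → IsPartialGame G (S ++ [m]) → I (S ++ [m])) :
    ∃ σ : Strategy V, IsWinningStrategy G P σ := by
  classical
  let σ : Strategy V := fun S =>
    if h : ∃ m, IsPartialGame G (S ++ [m]) ∧ I (S ++ [m]) then some h.choose else none
  have key : ∀ S, IsPartialGame G S → Follows P σ S → I S := by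
    intro S
    induction S using List.reverseRecOn with
    | nil => exact fun _ _ => h0
    | append_singleton S m ih =>
      intro hS hF
      have hS' := ((isPartialGame_append_singleton S m).1 hS).1
      have hI : I S := by
        refine ih hS' fun i h ht => ?_
        have := hF i (by simp; omega)
        rw [List.take_append_of_le_length h.le, List.getElem_append_left h] at this
        exact this ht
      by_cases ht : toMove S = P
      · have := hF S.length (by simp)
        simp only [List.take_left, List.getElem_concat_length] at this
        have hm := this ht
        have hex := hown S hS' hI ht
        simp only [σ, dif_pos hex, Option.some.injEq] at hm
        exact hm ▸ hex.choose_spec.2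
      · exact hopp S m hI ht hS
  refine ⟨σ, fun S hS hF ht _ => ?_, fun S hS hF hover ht => ?_⟩
  · have hex := hown S hS (key S hS hF) ht
    exact ⟨hex.choose, by simp only [σ, dif_pos hex], hex.choose_spec.1⟩
  · obtain ⟨m, hm, -⟩ := hown S hS (key S hS hF) ht
    exact hover m hm

/-- `P` can force a win from the partial game `S`. -/
inductive Winning (G : SimpleGraph V) (P : Player) : List (V × V) → Prop
  | own (S : List (V × V)) (m : V × V) (ht : toMove S = P) (hm : IsPartialGame G (S ++ [m]))
      (hw : Winning G P (S ++ [m])) : Winning G P S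
  | opp (S : List (V × V)) (ht : toMove S ≠ P)
      (hw : ∀ m, IsPartialGame G (S ++ [m]) → Winning G P (S ++ [m])) : Winning G P S

theorem Winning.exists_isWinningStrategy [Finite V] {P : Player} (h : Winning G P []) :
    ∃ σ : Strategy V, IsWinningStrategy G P σ := by
  refine TrailTrap.exists_isWinningStrategy (Winning G P) h ?_ ?_
  · rintro S - (⟨_, m, -, hm, hw⟩ | ⟨_, ht', -⟩) ht
    · exact ⟨m, hm, hw⟩
    · exact absurd ht ht'
  · rintro S m (⟨_, _, ht', -, -⟩ | ⟨_, -, hw⟩) ht hm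
    · exact absurd ht' ht
    · exact hw m hm

/-! ### The mirror strategy -/

/-- The games in which every move is followed by its image under `φ`. -/
inductive Mirrored (φ : V → V) : List (V × V) → Prop
  | nil : Mirrored φ []
  | snoc (S : List (V × V)) (m : V × V) (h : Mirrored φ S) :
      Mirrored φ (S ++ [m, (φ m.1, φ m.2)])

theorem Mirrored.even_length {φ : V → V} {S : List (V × V)} (h : Mirrored φ S) :
    Even S.length := by
  induction h with
  | nil => simp
  | snoc S m _ ih => simpa [Nat.even_add] using ih

theorem Mirrored.map_mem_edges {φ : V → V} (hφ : Function.Involutive φ) {S : List (V × V)}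
    (h : Mirrored φ S) {e : Sym2 V} (he : e ∈ S.map (fun m => s(m.1, m.2))) :
    e.map φ ∈ S.map (fun m => s(m.1, m.2)) := by
  induction h with
  | nil => simp at he
  | snoc S m _ ih =>
    rw [List.map_append, List.mem_append] at he ⊢
    rcases he with he | he
    · exact Or.inl (ih he)
    · right
      simp only [List.map_cons, List.map_nil, List.mem_cons, List.not_mem_nil, or_false] at he ⊢
      rcases he with rfl | rfl
      · right; simp
      · left; simp [hφ m.1, hφ m.2]

/-- If an involutive automorphism fixes no edge, the second player wins by copying every move of
the first player through it. -/
theorem p2Win_of_involutive [Finite V] {φ : V → V} (hφ : Function.Involutive φ)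
    (hadj : ∀ u v, G.Adj u v → G.Adj (φ u) (φ v))
    (hfix : ∀ u v, G.Adj u v → s(φ u, φ v) ≠ s(u, v)) : P2Win G := by
  refine exists_isWinningStrategy
    (fun S => Mirrored φ S ∨ ∃ S' m, Mirrored φ S' ∧ S = S' ++ [m]) (Or.inl .nil) ?_ ?_
  · rintro S hS (h | ⟨S, m, h, rfl⟩) ht
    · simp [toMove, h.even_length] at ht
    · refine ⟨(φ m.1, φ m.2), ?_, Or.inl (by simpa using Mirrored.snoc S m h)⟩
      obtain ⟨-, hm, hnew, hstart⟩ := (isPartialGame_append_singleton S m).1 hS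
      refine (isPartialGame_append_singleton _ _).2 ⟨hS, hadj _ _ hm, ?_, ?_⟩
      · rw [List.map_append, List.mem_append]
        rintro (he | he)
        · have := h.map_mem_edges hφ he
          simp only [Sym2.map_mk, hφ m.1, hφ m.2] at this
          exact hnew this
        · exact hfix _ _ hm (by simpa using he)
      · -- The mirrored move starts where the second player's previous move, also a mirrored
        -- move, ended.
        intro i hi
        cases h with
        | nil => simp at hi
        | snoc T a _ =>
          obtain rfl : i = T.length + 1 := by simp at hi; omega
          have := hstart T.length (by simp)
          simp at this ⊢
          rw [this]
  · rintro S m (h | ⟨S, m', h, rfl⟩) ht hm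
    · exact Or.inr ⟨S, m, h, rfl⟩
    · exact absurd (by simpa [toMove, Nat.even_add_one] using h.even_length) ht

end General

theorem Fin.rev_ne_self {n : ℕ} (hn : Even n) (i : Fin n) : i.rev ≠ i := by
  obtain ⟨k, rfl⟩ := hn
  intro h
  have := congrArg Fin.val h
  rw [Fin.val_rev] at this
  omega

theorem p2Win_completeBipartiteGraph {p q : ℕ} (h : Even p ∨ Even q) :
    P2Win (completeBipartiteGraph (Fin p) (Fin q)) := by
  rcases h with h | h
  · refine p2Win_of_involutive (φ := Sum.map Fin.rev id) ?_ ?_ ?_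
    · rintro (i | j) <;> simp
    · rintro (i | j) (i' | j') <;> simp
    · rintro (i | j) (i' | j') <;> simp [Fin.rev_ne_self h]
  · refine p2Win_of_involutive (φ := Sum.map id Fin.rev) ?_ ?_ ?_
    · rintro (i | j) <;> simp
    · rintro (i | j) (i' | j') <;> simp
    · rintro (i | j) (i' | j') <;> simp [Fin.rev_ne_self h]

end TrailTrap

/-! ### Positions on `K_{3,q}` -/

namespace TrailTrap

section Position

variable {B : Type*} [DecidableEq B]

/-- A position on the complete bipartite graph with parts `Fin 3` and `B` is described by the
function `r` sending `b : B` to the set of those `i : Fin 3` for which the edge `ib` is unused.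
`take r i b` is the description after the edge `ib` has been used. -/
def take (r : B → Finset (Fin 3)) (i : Fin 3) (b : B) : B → Finset (Fin 3) :=
  Function.update r b ((r b).erase i)

theorem mem_take {r : B → Finset (Fin 3)} {i j : Fin 3} {b c : B} :
    j ∈ take r i b c ↔ j ∈ r c ∧ ¬ (j = i ∧ c = b) := by
  unfold take
  rcases eq_or_ne c b with rfl | h
  · simp [and_comm]
  · simp [h]

@[simp] theorem take_self (r : B → Finset (Fin 3)) (i : Fin 3) (b : B) :
    take r i b b = (r b).erase i := by
  simp [take]

theorem take_of_ne (r : B → Finset (Fin 3)) (i : Fin 3) {b c : B} (h : c ≠ b) :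
    take r i b c = r c := by
  simp [take, h]

/-- `PosWin P r u v`: the first player wins the position with unused edges `r` in which `P` is to
move, the token of the first player is at `u` and that of the second player is at `v`. -/
inductive PosWin : Player → (B → Finset (Fin 3)) → Fin 3 ⊕ B → Fin 3 ⊕ B → Prop
  | oneLeft (r i v b) (h : i ∈ r b) (hw : PosWin .two (take r i b) (.inr b) v) :
      PosWin .one r (.inl i) v
  | oneRight (r b v i) (h : i ∈ r b) (hw : PosWin .two (take r i b) (.inl i) v) :
      PosWin .one r (.inr b) v
  | twoLeft (r u l) (hw : ∀ b, l ∈ r b → PosWin .one (take r l b) u (.inr b)) :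
      PosWin .two r u (.inl l)
  | twoRight (r u b) (hw : ∀ l, l ∈ r b → PosWin .one (take r l b) u (.inl l)) :
      PosWin .two r u (.inr b)

/-- The effect of passing from `l` through `c` to `l'` and, alternately, from `i` through `b`
to `i'`. -/
theorem take_take_take_take {r : B → Finset (Fin 3)} {b c : B} (hbc : b ≠ c) (i i' l l' : Fin 3) :
    take (take (take (take r l c) i b) l' c) i' b =
      Function.update (Function.update r c (((r c).erase l).erase l')) b
        (((r b).erase i).erase i') := by
  funext a
  rcases eq_or_ne a b with rfl | hab
  · simp [take, hbc]
  · rcases eq_or_ne a c with rfl | hac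
    · simp [take, hab]
    · simp [take, hab, hac]

/-- The second player is stuck at a right vertex whose remaining edges have all been used. -/
theorem posWin_of_eq_empty {r : B → Finset (Fin 3)} {u : Fin 3 ⊕ B} {b : B} (hb : r b = ∅) :
    PosWin .two r u (.inr b) :=
  .twoRight _ _ _ fun l hl => by simp [hb] at hl

/-- If the second player enters a vertex with a single unused edge, any legal move of the first
player wins. -/
theorem posWin_of_enter_single {i l : Fin 3} {r : B → Finset (Fin 3)} {b c : B}
    (hc : r c = {l}) (hbc : b ≠ c) (hb : i ∈ r b) : PosWin .one (take r l c) (.inl i) (.inr c) := by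
  refine .oneLeft _ _ _ b (by rwa [take_of_ne _ _ hbc]) (posWin_of_eq_empty ?_)
  rw [take_of_ne _ _ hbc.symm, take_self, hc, Finset.erase_singleton]

/-- The second player passes through `c`, the first player through `b`. -/
theorem posWin_round {i l : Fin 3} {r : B → Finset (Fin 3)} {b c : B} (hbc : b ≠ c) (hb : i ∈ r b)
    (h : ∀ l' ∈ (r c).erase l, ∃ i' ∈ (r b).erase i,
      PosWin .two (Function.update (Function.update r c (((r c).erase l).erase l')) b
        (((r b).erase i).erase i')) (.inl i') (.inl l')) :
    PosWin .one (take r l c) (.inl i) (.inr c) := by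
  refine .oneLeft _ _ _ b (by rwa [take_of_ne _ _ hbc]) (.twoRight _ _ _ fun l' hl' => ?_)
  rw [take_of_ne _ _ hbc.symm, take_self] at hl'
  obtain ⟨i', hi', hw⟩ := h l' hl'
  refine .oneRight _ _ _ i' ?_ ?_
  · rwa [take_of_ne _ _ hbc, take_self, take_of_ne _ _ hbc]
  · rwa [take_take_take_take hbc]

/-- `r` describes the edges not used in `S`. -/
def Unused (S : List ((Fin 3 ⊕ B) × (Fin 3 ⊕ B))) (r : B → Finset (Fin 3)) : Prop :=
  ∀ i b, i ∈ r b ↔ s(Sum.inl i, Sum.inr b) ∉ S.map (fun m => s(m.1, m.2))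

theorem Unused.append {S : List ((Fin 3 ⊕ B) × (Fin 3 ⊕ B))} {r : B → Finset (Fin 3)}
    (h : Unused S r) {m : (Fin 3 ⊕ B) × (Fin 3 ⊕ B)} {i : Fin 3} {b : B}
    (hm : s(m.1, m.2) = s(Sum.inl i, Sum.inr b)) : Unused (S ++ [m]) (take r i b) := by
  intro j c
  rw [mem_take, h j c, List.map_append, List.mem_append, not_or]
  simp [hm]

theorem winning_of_posWin {P : Player} {r : B → Finset (Fin 3)} {u v : Fin 3 ⊕ B}
    (h : PosWin P r u v) : ∀ S a b, IsPartialGame (completeBipartiteGraph (Fin 3) B) (S ++ [a, b]) →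
      toMove (S ++ [a, b]) = P → Unused (S ++ [a, b]) r →
      (P = .one → a.2 = u ∧ b.2 = v) → (P = .two → a.2 = v ∧ b.2 = u) →
      Winning (completeBipartiteGraph (Fin 3) B) .one (S ++ [a, b]) := by
  induction h with
  | oneLeft r i v c h _ ih =>
    intro S a b hS ht hr h1 _
    obtain ⟨ha, hb⟩ := h1 rfl
    have hm := (isPartialGame_append_pair_append S a b (.inl i, .inr c)).2
      ⟨hS, by simp, (hr i c).1 h, ha⟩
    refine .own _ _ ht hm ?_
    have e : S ++ [a, b] ++ [(.inl i, .inr c)] = (S ++ [a]) ++ [b, (.inl i, .inr c)] := by simp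
    have ht' := (toMove_append_singleton (S ++ [a, b]) (.inl i, .inr c) .two).2 (by simp [ht])
    have hr' := hr.append (m := (.inl i, .inr c)) rfl
    rw [e] at hm ht' hr' ⊢
    exact ih _ _ _ hm ht' hr' (by simp) (by simp [hb])
  | oneRight r c v i h _ ih =>
    intro S a b hS ht hr h1 _
    obtain ⟨ha, hb⟩ := h1 rfl
    have hm := (isPartialGame_append_pair_append S a b (.inr c, .inl i)).2
      ⟨hS, by simp, by simpa only [Sym2.eq_swap] using (hr i c).1 h, ha⟩
    refine .own _ _ ht hm ?_
    have e : S ++ [a, b] ++ [(.inr c, .inl i)] = (S ++ [a]) ++ [b, (.inr c, .inl i)] := by simp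
    have ht' := (toMove_append_singleton (S ++ [a, b]) (.inr c, .inl i) .two).2 (by simp [ht])
    have hr' := hr.append (m := (.inr c, .inl i)) Sym2.eq_swap
    rw [e] at hm ht' hr' ⊢
    exact ih _ _ _ hm ht' hr' (by simp) (by simp [hb])
  | twoLeft r u l _ ih =>
    intro S a b hS ht hr _ h2
    obtain ⟨ha, hb⟩ := h2 rfl
    refine .opp _ (by simp [ht]) fun m hm => ?_
    obtain ⟨-, hadj, hnew, hstart⟩ := (isPartialGame_append_pair_append S a b m).1 hm
    obtain ⟨x, y⟩ := m
    obtain rfl : x = .inl l := by rw [← ha, hstart]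
    rcases y with j | c
    · simp at hadj
    have e : S ++ [a, b] ++ [(.inl l, .inr c)] = (S ++ [a]) ++ [b, (.inl l, .inr c)] := by simp
    have ht' := (toMove_append_singleton (S ++ [a, b]) (.inl l, .inr c) .one).2 (by simp [ht])
    have hr' := hr.append (m := (.inl l, .inr c)) rfl
    rw [e] at hm ht' hr' ⊢
    exact ih c ((hr l c).2 hnew) _ _ _ hm ht' hr' (by simp [hb]) (by simp)
  | twoRight r u c _ ih =>
    intro S a b hS ht hr _ h2
    obtain ⟨ha, hb⟩ := h2 rfl
    refine .opp _ (by simp [ht]) fun m hm => ?_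
    obtain ⟨-, hadj, hnew, hstart⟩ := (isPartialGame_append_pair_append S a b m).1 hm
    obtain ⟨x, y⟩ := m
    obtain rfl : x = .inr c := by rw [← ha, hstart]
    rcases y with l | j
    swap
    · simp at hadj
    have e : S ++ [a, b] ++ [(.inr c, .inl l)] = (S ++ [a]) ++ [b, (.inr c, .inl l)] := by simp
    have ht' := (toMove_append_singleton (S ++ [a, b]) (.inr c, .inl l) .one).2 (by simp [ht])
    have hr' := hr.append (m := (.inr c, .inl l)) Sym2.eq_swap
    rw [e] at hm ht' hr' ⊢
    exact ih l ((hr l c).2 (by simpa only [Sym2.eq_swap] using hnew)) _ _ _ hm ht' hr'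
      (by simp [hb]) (by simp)

/-- The first player opens by moving from the left vertex `0` to a right vertex `b₀`; the second
player then picks an edge `lb` and one of its two orientations. -/
theorem p1Win_of_posWin [Finite B] (b₀ : B)
    (hin : ∀ l b, l ∈ take (fun _ => Finset.univ) 0 b₀ b →
      PosWin .one (take (take (fun _ => Finset.univ) 0 b₀) l b) (.inr b₀) (.inr b))
    (hout : ∀ l b, l ∈ take (fun _ => Finset.univ) 0 b₀ b →
      PosWin .one (take (take (fun _ => Finset.univ) 0 b₀) l b) (.inr b₀) (.inl l)) :
    P1Win (completeBipartiteGraph (Fin 3) B) := by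
  refine Winning.exists_isWinningStrategy (.own [] (.inl 0, .inr b₀) (by simp [toMove]) ?_ ?_)
  · exact (isPartialGame_singleton _).2 (by simp)
  have hr₀ : Unused ([] : List ((Fin 3 ⊕ B) × (Fin 3 ⊕ B))) (fun _ => Finset.univ) := by
    intro i b; simp
  have hr₁ := hr₀.append (m := (.inl 0, .inr b₀)) rfl
  refine .opp _ (by simp [toMove]) fun m hm => ?_
  rw [List.nil_append] at *
  obtain ⟨-, hadj, hne⟩ := (isPartialGame_pair _ m).1 hm
  obtain ⟨x | x, y | y⟩ := m
  · simp at hadj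
  · have hmem : x ∈ take (fun _ => Finset.univ) 0 b₀ y := (hr₁ x y).2 (by simpa using hne)
    exact winning_of_posWin (hin x y hmem) [] _ _ hm (by simp [toMove])
      (hr₁.append (m := (.inl x, .inr y)) rfl) (by simp) (by simp)
  · have hmem : y ∈ take (fun _ => Finset.univ) 0 b₀ x :=
      (hr₁ y x).2 (by rw [Sym2.eq_swap]; simpa using hne)
    exact winning_of_posWin (hout y x hmem) [] _ _ hm (by simp [toMove])
      (hr₁.append (m := (.inr x, .inl y)) Sym2.eq_swap) (by simp) (by simp)
  · simp at hadj

end Position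

end TrailTrap

/-! ### Counting right vertices by their unused edges -/

namespace TrailTrap

section Counting

variable {B : Type*} [Fintype B]

/-- Among the right vertices, `n` have all three edges unused, `x i` have only the edge to `i`
unused, and exactly those two edges that avoid `t` are unused at one vertex if `d = some t` and at
none otherwise. -/
structure Counts (r : B → Finset (Fin 3)) (n : ℕ) (x : Fin 3 → ℕ) (d : Option (Fin 3)) :
    Prop where
  fresh : (Finset.univ.filter fun b => r b = Finset.univ).card = n
  single : ∀ i, (Finset.univ.filter fun b => r b = {i}).card = x i
  double : ∀ t, (Finset.univ.filter fun b => r b = {t}ᶜ).card = if d = some t then 1 else 0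

theorem card_filter_update [DecidableEq B] (r : B → Finset (Fin 3)) (b : B) (T S : Finset (Fin 3)) :
    (Finset.univ.filter fun c => Function.update r b T c = S).card + (if r b = S then 1 else 0) =
      (Finset.univ.filter fun c => r c = S).card + if T = S then 1 else 0 := by
  have h : ∀ f : B → Finset (Fin 3), (Finset.univ.filter fun c => f c = S).card =
      (if f b = S then 1 else 0) + ((Finset.univ.erase b).filter fun c => f c = S).card := by
    intro f
    rw [Finset.card_filter, Finset.card_filter]
    exact (Finset.add_sum_erase _ (fun c => if f c = S then 1 else 0) (Finset.mem_univ b)).symm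
  rw [h, h r, Function.update_self]
  have : ((Finset.univ.erase b).filter fun c => Function.update r b T c = S) =
      ((Finset.univ.erase b).filter fun c => r c = S) := by
    refine Finset.filter_congr fun c hc => ?_
    rw [Function.update_of_ne (Finset.ne_of_mem_erase hc)]
  rw [this]
  omega

theorem eq_singleton_or (S : Finset (Fin 3)) : S = ∅ ∨ S = Finset.univ ∨ (∃ i, S = {i}) ∨
    ∃ t, S = {t}ᶜ := by
  revert S; decide

theorem univ_ne_singleton (i : Fin 3) : (Finset.univ : Finset (Fin 3)) ≠ {i} := by
  revert i; decide

theorem univ_ne_compl (i : Fin 3) : (Finset.univ : Finset (Fin 3)) ≠ {i}ᶜ := by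
  revert i; decide

theorem singleton_ne_compl (i j : Fin 3) : ({i} : Finset (Fin 3)) ≠ {j}ᶜ := by
  revert i j; decide

theorem empty_ne_compl (i : Fin 3) : (∅ : Finset (Fin 3)) ≠ {i}ᶜ := by
  revert i; decide

theorem empty_ne_univ : (∅ : Finset (Fin 3)) ≠ Finset.univ := by
  decide

/-- The element of `Fin 3` different from `i` and `j` is `-(i + j)`, since `0 + 1 + 2 = 0`. -/
theorem univ_erase_erase {i j : Fin 3} (h : j ≠ i) :
    ((Finset.univ : Finset (Fin 3)).erase i).erase j = {-(i + j)} := by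
  revert i j; decide

theorem compl_erase {i t : Fin 3} (h : i ≠ t) :
    (({t}ᶜ : Finset (Fin 3)).erase i) = {-(i + t)} := by
  revert i t; decide

theorem neg_add_ne_left {i j : Fin 3} (h : i ≠ j) : -(i + j) ≠ i := by
  revert i j; decide

theorem neg_add_ne_right {i j : Fin 3} (h : i ≠ j) : -(i + j) ≠ j := by
  revert i j; decide

namespace Counts

variable {r : B → Finset (Fin 3)} {n : ℕ} {x : Fin 3 → ℕ} {d : Option (Fin 3)}

theorem exists_fresh (h : Counts r n x d) (hn : 0 < n) : ∃ b, r b = Finset.univ := by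
  rw [← h.fresh, Finset.card_pos] at hn
  obtain ⟨b, hb⟩ := hn
  exact ⟨b, by simpa using hb⟩

theorem exists_fresh_ne (h : Counts r n x d) (hn : 1 < n) (b : B) :
    ∃ c, c ≠ b ∧ r c = Finset.univ := by
  rw [← h.fresh] at hn
  obtain ⟨c, hc, hcb⟩ := Finset.exists_mem_ne hn b
  exact ⟨c, hcb, by simpa using hc⟩

theorem exists_double {t : Fin 3} (h : Counts r n x (some t)) : ∃ b, r b = {t}ᶜ := by
  have := h.double t
  rw [if_pos rfl] at this
  obtain ⟨b, hb⟩ := Finset.card_pos.1 (this ▸ one_pos)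
  exact ⟨b, by simpa using hb⟩

theorem double_eq {t : Fin 3} (h : Counts r n x d) {b : B} (hb : r b = {t}ᶜ) : d = some t := by
  by_contra hd
  have := h.double t
  rw [if_neg hd, Finset.card_eq_zero] at this
  have hb' : b ∈ Finset.univ.filter fun b => r b = {t}ᶜ := by simpa using hb
  simp [this] at hb'

theorem single_pos {i : Fin 3} (h : Counts r n x d) {b : B} (hb : r b = {i}) : 0 < x i := by
  rw [← h.single, Finset.card_pos]
  exact ⟨b, by simpa using hb⟩

theorem fresh_pos (h : Counts r n x d) {b : B} (hb : r b = Finset.univ) : 0 < n := by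
  rw [← h.fresh, Finset.card_pos]
  exact ⟨b, by simpa using hb⟩

/-- A fresh vertex that has been passed through becomes a vertex with a single unused edge. -/
theorem update_fresh [DecidableEq B] (h : Counts r n x d) {b : B} (hb : r b = Finset.univ)
    (k : Fin 3) :
    Counts (Function.update r b {k}) (n - 1) (x + Pi.single k 1) d := by
  have h0 := h.fresh_pos hb
  refine ⟨?_, fun i => ?_, fun t => ?_⟩
  · have := card_filter_update r b {k} Finset.univ
    rw [h.fresh, if_pos hb, if_neg (univ_ne_singleton k).symm] at this
    omega
  · have := card_filter_update r b {k} {i}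
    rw [h.single, hb, if_neg (univ_ne_singleton i)] at this
    rw [Pi.add_apply, Pi.single_apply]
    simpa [eq_comm] using this
  · have := card_filter_update r b {k} {t}ᶜ
    rw [h.double, hb, if_neg (univ_ne_compl t), if_neg (singleton_ne_compl k t)] at this
    simpa using this

theorem update_double [DecidableEq B] {t : Fin 3} (h : Counts r n x (some t)) {b : B}
    (hb : r b = {t}ᶜ) :
    Counts (Function.update r b ∅) n x none := by
  refine ⟨?_, fun i => ?_, fun s => ?_⟩
  · have := card_filter_update r b ∅ Finset.univ
    rw [h.fresh, hb, if_neg (univ_ne_compl t).symm, if_neg empty_ne_univ] at this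
    omega
  · have := card_filter_update r b ∅ {i}
    rw [h.single, hb, if_neg (singleton_ne_compl i t).symm,
      if_neg (Finset.singleton_ne_empty i).symm] at this
    omega
  · have := card_filter_update r b ∅ {s}ᶜ
    rw [h.double, hb, if_neg (empty_ne_compl s)] at this
    have e : (({t}ᶜ : Finset (Fin 3)) = {s}ᶜ) ↔ some t = some s := by simp
    simp only [e] at this
    simpa using this

/-- A fresh vertex at which the edge to `t` has been used becomes the vertex with two unused
edges. -/
theorem update_compl [DecidableEq B] (h : Counts r n x none) {b : B} (hb : r b = Finset.univ)
    (t : Fin 3) :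
    Counts (Function.update r b {t}ᶜ) (n - 1) x (some t) := by
  have h0 := h.fresh_pos hb
  refine ⟨?_, fun i => ?_, fun s => ?_⟩
  · have := card_filter_update r b {t}ᶜ Finset.univ
    rw [h.fresh, if_pos hb, if_neg (univ_ne_compl t).symm] at this
    omega
  · have := card_filter_update r b {t}ᶜ {i}
    rw [h.single, hb, if_neg (univ_ne_singleton i), if_neg (singleton_ne_compl i t).symm] at this
    omega
  · have := card_filter_update r b {t}ᶜ {s}ᶜ
    rw [h.double, hb, if_neg (univ_ne_compl s)] at this
    simpa using this

theorem update_fresh_fresh [DecidableEq B] (h : Counts r n x d) {b c : B} (hb : r b = Finset.univ)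
    (hc : r c = Finset.univ) (hbc : b ≠ c) (k m : Fin 3) :
    Counts (Function.update (Function.update r c {m}) b {k}) (n - 2)
      (x + Pi.single m 1 + Pi.single k 1) d :=
  (h.update_fresh hc m).update_fresh (by rw [Function.update_of_ne hbc, hb]) k

/-- A fresh vertex at which all edges have been used. -/
theorem update_empty [DecidableEq B] (h : Counts r n x none) {b : B} (hb : r b = Finset.univ) :
    Counts (Function.update r b ∅) (n - 1) x none := by
  simpa using (h.update_compl hb 0).update_double (Function.update_self b _ r)

end Counts

theorem counts_univ : Counts (fun _ : B => (Finset.univ : Finset (Fin 3))) (Fintype.card B) 0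
    none := by
  refine ⟨by simp, fun i => ?_, fun t => ?_⟩
  · simp [univ_ne_singleton]
  · simp [univ_ne_compl]

end Counting

end TrailTrap

/-! ### Tokens in phase -/

namespace TrailTrap

section InPhase

variable {B : Type*} [Fintype B] [DecidableEq B]

/-- If both tokens leave and enter the left part together, then the first player wins by always
entering fresh vertices, as their number is odd at the beginning of each round. In the position
considered, the first player has just moved from `i` to the fresh vertex `b` and the second player
from `l` to `c`. -/
theorem posWin_in_phase (m : ℕ) : ∀ (r : B → Finset (Fin 3)) (x : Fin 3 → ℕ) (i l : Fin 3)
    (b c : B), Counts r (2 * m + 1) x none → r b = Finset.univ → l ∈ take r i b c →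
      PosWin .one (take (take r i b) l c) (.inr b) (.inr c) := by
  induction m using Nat.strong_induction_on with
  | _ m ih =>
  intro r x i l b c h hb hl
  rcases eq_or_ne c b with rfl | hcb
  · -- Both tokens are at `c`, and the first player takes the last edge there.
    rw [take_self, hb, Finset.mem_erase] at hl
    have hk : take (take r i c) l c c = {-(i + l)} := by
      rw [take_self, take_self, hb, univ_erase_erase hl.1]
    refine .oneRight _ _ _ (-(i + l)) (by rw [hk]; exact Finset.mem_singleton_self _)
      (posWin_of_eq_empty ?_)
    rw [take_self, hk, Finset.erase_singleton]
  have hi : i + 1 ≠ i := by simp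
  have hexit : i + 1 ∈ take (take r i b) l c b := by
    rw [take_of_ne _ _ hcb.symm, take_self, hb]
    simp
  rw [take_of_ne _ _ hcb] at hl
  obtain hc | hc | ⟨j, hc⟩ | ⟨t, hc⟩ := eq_singleton_or (r c)
  · simp [hc] at hl
  · obtain ⟨k, rfl⟩ : ∃ k, m = k + 1 := by
      cases m with
      | zero =>
        have := Finset.card_le_one.1 h.fresh.le b (by simpa using hb) c (by simpa using hc)
        exact absurd this.symm hcb
      | succ k => exact ⟨k, rfl⟩
    refine .oneRight _ _ _ _ hexit (.twoRight _ _ _ fun l' hl' => ?_)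
    rw [take_of_ne _ _ hcb, take_self, take_of_ne _ _ hcb, hc, Finset.mem_erase] at hl'
    rw [take_take_take_take hcb, hb, hc, univ_erase_erase hi, univ_erase_erase hl'.1]
    have h' := h.update_fresh_fresh hc hb hcb (-(l + l')) (-(i + (i + 1)))
    obtain ⟨e, he⟩ := h'.exists_fresh (by omega)
    exact .oneLeft _ _ _ e (he ▸ Finset.mem_univ _)
      (.twoLeft _ _ _ fun c' hc' => ih k (by omega) _ _ _ _ _ _ h' he hc')
  · obtain rfl : l = j := by simpa [hc] using hl
    refine .oneRight _ _ _ _ hexit (posWin_of_eq_empty ?_)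
    rw [take_of_ne _ _ hcb, take_self, take_of_ne _ _ hcb, hc, Finset.erase_singleton]
  · exact absurd (h.double_eq hc) (by simp)

end InPhase

/-! ### Tokens out of phase -/

section OutOfPhase

/-- The first player wins whenever the second player is to move, both tokens are in the left part,
at `i` and `l` respectively, and the unused edges are counted by `n`, `x` and `d`. -/
def Good (B : Type*) [Fintype B] [DecidableEq B] (n : ℕ) (x : Fin 3 → ℕ) (d : Option (Fin 3))
    (i l : Fin 3) : Prop :=
  ∀ r : B → Finset (Fin 3), Counts r n x d → PosWin .two r (.inl i) (.inl l)

variable {B : Type*} [Fintype B] [DecidableEq B] {n : ℕ} {x : Fin 3 → ℕ} {d : Option (Fin 3)}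
  {i l : Fin 3}

theorem good_zero (h : x l = 0 ∨ (if i = l then 1 else 0) < x i) : Good B 0 x none i l := by
  intro r hr
  refine .twoLeft _ _ _ fun c hl => ?_
  obtain hc | hc | ⟨j, hc⟩ | ⟨t, hc⟩ := eq_singleton_or (r c)
  · simp [hc] at hl
  · exact absurd (hr.fresh_pos hc) (lt_irrefl 0)
  · obtain rfl : l = j := by simpa [hc] using hl
    have hx := h.resolve_left (hr.single_pos hc).ne'
    obtain ⟨b, hbc, hb⟩ : ∃ b, b ≠ c ∧ r b = {i} := by
      rw [← hr.single] at hx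
      split_ifs at hx with hil
      · obtain ⟨b, hb, hbc⟩ := Finset.exists_mem_ne hx c
        exact ⟨b, hbc, by simpa using hb⟩
      · obtain ⟨b, hb⟩ := Finset.card_pos.1 hx
        have hb : r b = {i} := by simpa using hb
        refine ⟨b, ?_, hb⟩
        rintro rfl
        exact hil (Finset.singleton_injective (hb.symm.trans hc))
    exact posWin_of_enter_single hc hbc (by simp [hb])
  · exact absurd (hr.double_eq hc) (by simp)

theorem good_add_two
    (h : ∀ l' ≠ l, ∃ i' ≠ i,
      Good B n (x + Pi.single (-(l + l')) 1 + Pi.single (-(i + i')) 1) none i' l') :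
    Good B (n + 2) x none i l := by
  intro r hr
  refine .twoLeft _ _ _ fun c hl => ?_
  obtain ⟨b, hbc, hb⟩ := hr.exists_fresh_ne (by omega) c
  have hib : i ∈ r b := by simp [hb]
  obtain hc | hc | ⟨j, hc⟩ | ⟨t, hc⟩ := eq_singleton_or (r c)
  · simp [hc] at hl
  · refine posWin_round hbc hib fun l' hl' => ?_
    rw [hc, Finset.mem_erase] at hl'
    obtain ⟨i', hi', hg⟩ := h l' hl'.1
    refine ⟨i', by simp [hb, hi'], hg _ ?_⟩
    rw [hc, hb, univ_erase_erase hl'.1, univ_erase_erase hi']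
    exact hr.update_fresh_fresh hb hc hbc _ _
  · obtain rfl : l = j := by simpa [hc] using hl
    exact posWin_of_enter_single hc hbc hib
  · exact absurd (hr.double_eq hc) (by simp)

/-- A vertex with two unused edges is available. If the second player enters a fresh vertex, the
first player answers there (`hdouble`) or at another fresh vertex (`hfresh`); if the second player
enters it (`hopp`), the first player answers at a fresh vertex. -/
theorem good_some {t : Fin 3}
    (hown : (i ≠ t ∧ ∀ l' ≠ l, Good B n (x + Pi.single (-(l + l')) 1) none (-(i + t)) l') ∨
      ∃ k, n = k + 1 ∧ ∀ l' ≠ l, ∃ i' ≠ i,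
        Good B k (x + Pi.single (-(l + l')) 1 + Pi.single (-(i + i')) 1) (some t) i' l')
    (hopp : l ≠ t → ∃ i' ≠ i, Good B n (x + Pi.single (-(i + i')) 1) none i' (-(l + t))) :
    Good B (n + 1) x (some t) i l := by
  intro r hr
  refine .twoLeft _ _ _ fun c hl => ?_
  obtain ⟨f, hf⟩ := hr.exists_fresh (by omega)
  have hif : i ∈ r f := by simp [hf]
  obtain hc | hc | ⟨j, hc⟩ | ⟨s, hc⟩ := eq_singleton_or (r c)
  · simp [hc] at hl
  · obtain ⟨hit, h⟩ | ⟨k, rfl, h⟩ := hown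
    · obtain ⟨b, hb⟩ := hr.exists_double
      have hbc : b ≠ c := by
        rintro rfl
        exact univ_ne_compl t (hc.symm.trans hb)
      refine posWin_round hbc (by simp [hb, hit]) fun l' hl' => ?_
      rw [hc, Finset.mem_erase] at hl'
      refine ⟨-(i + t), by rw [hb, compl_erase hit]; exact Finset.mem_singleton_self _,
        h l' hl'.1 _ ?_⟩
      rw [hc, hb, univ_erase_erase hl'.1, compl_erase hit, Finset.erase_singleton]
      exact (hr.update_fresh hc _).update_double (by rw [Function.update_of_ne hbc, hb])
    · obtain ⟨b, hbc, hb⟩ := hr.exists_fresh_ne (by omega) c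
      refine posWin_round hbc (by simp [hb]) fun l' hl' => ?_
      rw [hc, Finset.mem_erase] at hl'
      obtain ⟨i', hi', hg⟩ := h l' hl'.1
      refine ⟨i', by simp [hb, hi'], hg _ ?_⟩
      rw [hc, hb, univ_erase_erase hl'.1, univ_erase_erase hi']
      exact hr.update_fresh_fresh hb hc hbc _ _
  · obtain rfl : l = j := by simpa [hc] using hl
    refine posWin_of_enter_single hc ?_ hif
    rintro rfl
    exact univ_ne_singleton l (hf.symm.trans hc)
  · obtain rfl : t = s := Option.some_injective _ (hr.double_eq hc)
    have hlt : l ≠ t := by simpa [hc] using hl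
    have hfc : f ≠ c := by
      rintro rfl
      exact univ_ne_compl t (hf.symm.trans hc)
    obtain ⟨i', hi', hg⟩ := hopp hlt
    refine posWin_round hfc hif fun l' hl' => ⟨i', by simp [hf, hi'], ?_⟩
    rw [hc, compl_erase hlt, Finset.mem_singleton] at hl'
    subst hl'
    refine hg _ ?_
    rw [hc, hf, univ_erase_erase hi', compl_erase hlt, Finset.erase_singleton,
      Function.update_comm hfc.symm]
    exact (hr.update_fresh hf _).update_double (by rw [Function.update_of_ne hfc.symm, hc])

end OutOfPhase

end TrailTrap

/-! ### Positions won by the first player -/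

namespace TrailTrap

section

variable {B : Type*} [Fintype B] [DecidableEq B]

/-- The first player leaves the edges to `j` unused until the last round, and then goes to `j`. -/
theorem good_of_two_le (m : ℕ) : ∀ (x : Fin 3 → ℕ) (i l j : Fin 3), j ≠ i → 2 ≤ x j →
    Good B (2 * m + 2) x none i l := by
  induction m with
  | zero =>
    intro x i l j hji hx
    refine good_add_two fun l' hl' => ⟨j, hji, good_zero (.inr ?_)⟩
    simp only [Pi.add_apply]
    split_ifs <;> omega
  | succ m ih =>
    intro x i l j hji hx
    refine good_add_two fun l' hl' => ⟨-(i + j), neg_add_ne_left hji.symm,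
      ih _ _ _ j (neg_add_ne_right hji.symm).symm ?_⟩
    simp only [Pi.add_apply]
    omega

/-- A condition under which the first player, at `i`, wins if there are a positive even number of
fresh vertices. -/
def Enough (x : Fin 3 → ℕ) (i : Fin 3) : Prop :=
  (∃ j, j ≠ i ∧ 2 ≤ x j) ∨ ∀ j, j ≠ i → 1 ≤ x j

instance (x : Fin 3 → ℕ) (i : Fin 3) : Decidable (Enough x i) := by
  unfold Enough; infer_instance

theorem good_of_enough (m : ℕ) {x : Fin 3 → ℕ} {i l : Fin 3} (h : Enough x i) :
    Good B (2 * m + 2) x none i l := by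
  obtain ⟨j, hj, hx⟩ | h := h
  · exact good_of_two_le m x i l j hj hx
  · cases m with
    | zero =>
      refine good_add_two fun l' hl' => ?_
      obtain ⟨i', hi', hil⟩ : ∃ i', i' ≠ i ∧ i' ≠ l' := by
        clear * -
        revert i l'; decide
      refine ⟨i', hi', good_zero (.inr ?_)⟩
      have := h i' hi'
      simp only [Pi.add_apply, if_neg hil]
      omega
    | succ m =>
      have hi : i ≠ i + 1 := by simp
      refine good_add_two fun l' hl' => ⟨i + 1, hi.symm,
        good_of_two_le m _ _ _ (-(i + (i + 1))) (neg_add_ne_right hi) ?_⟩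
      have := h _ (neg_add_ne_left hi)
      simp only [Pi.add_apply, Pi.single_eq_same]
      omega

/-- The second player has started from the right vertex the first player had just reached. -/
theorem good_start_same (m : ℕ) {s : Fin 3} (hs : s ≠ 0) :
    Good B (2 * m + 4) 0 none (-(0 + s)) s := by
  have key : ∀ s : Fin 3, s ≠ 0 → ∀ l', l' ≠ s → ∃ i', i' ≠ -(0 + s) ∧
      Enough (0 + Pi.single (-(s + l')) 1 + Pi.single (-(-(0 + s) + i')) 1) i' := by
    decide
  refine good_add_two fun l' hl' => ?_
  obtain ⟨i', hi', h⟩ := key s hs l' hl'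
  exact ⟨i', hi', good_of_enough m h⟩

/-- The second player has started from a fresh right vertex, where two edges remain unused, to `s`.
The first player leaves the right part for `u`. -/
theorem good_start_fresh (m : ℕ) (s : Fin 3) :
    ∃ u, u ≠ 0 ∧ Good B (2 * m + 3) (Pi.single (-(0 + u)) 1) (some s) u s := by
  have key_large : ∀ s : Fin 3, ∃ u, u ≠ 0 ∧ u ≠ s ∧ ∀ l, l ≠ s → ∀ l', l' ≠ l →
      ∃ i', i' ≠ -(u + s) ∧ Enough (Pi.single (-(0 + u)) 1 + Pi.single (-(s + l)) 1 +
        Pi.single (-(l + l')) 1 + Pi.single (-(-(u + s) + i')) 1) i' := by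
    decide
  cases m with
  | succ m =>
    -- The first player passes through the vertex with two unused edges at once.
    obtain ⟨u, hu, hus, h⟩ := key_large s
    refine ⟨u, hu, good_some (.inl ⟨hus, fun l hl => good_add_two fun l' hl' => ?_⟩)
      fun hs => absurd rfl hs⟩
    obtain ⟨i', hi', h⟩ := h l hl l' hl'
    exact ⟨i', hi', good_of_enough m h⟩
  | zero =>
    rcases eq_or_ne s 0 with rfl | hs
    · have key : ∀ l : Fin 3, l ≠ 0 → ∀ l', l' ≠ l → ∃ i', i' ≠ -(1 + 0 : Fin 3) ∧
          ∀ x : Fin 3 → ℕ, x = Pi.single (-(0 + 1)) 1 + Pi.single (-(0 + l)) 1 +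
            Pi.single (-(l + l')) 1 + Pi.single (-(-(1 + 0) + i')) 1 →
          (x l' = 0 ∨ (if i' = l' then 1 else 0) < x i') := by
        simp only [forall_eq]
        decide
      refine ⟨1, by decide, good_some (.inl ⟨by decide, fun l hl => good_add_two fun l' hl' => ?_⟩)
        fun hs => absurd rfl hs⟩
      obtain ⟨i', hi', h⟩ := key l hl l' hl'
      exact ⟨i', hi', good_zero (h _ rfl)⟩
    · -- With three fresh vertices left, passing at once through the vertex with two unused edges
      -- need not win. The first player delays this, and finally stops at `-(0 + s)`.
      have key : ∀ s : Fin 3, s ≠ 0 → ∀ l', l' ≠ s → ∀ k,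
          2 ≤ (Pi.single (-(0 + s)) 1 + Pi.single (-(s + l')) 1 + Pi.single (-(s + 0)) 1 +
            Pi.single k 1 : Fin 3 → ℕ) (-(0 + s)) := by
        decide
      refine ⟨s, hs, good_some (.inr ⟨1, rfl, fun l' hl' => ⟨0, hs.symm, ?_⟩⟩)
        fun hs => absurd rfl hs⟩
      refine good_some (.inl ⟨hs.symm, fun l'' _ => good_zero (.inr ?_)⟩)
        fun _ => ⟨-(0 + s), neg_add_ne_left hs.symm, good_zero (.inr ?_)⟩
      · have := key s hs l' hl' (-(l' + l''))
        split_ifs <;> omega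
      · have := key s hs l' hl' (-(0 + -(0 + s)))
        split_ifs <;> omega

theorem p1Win_completeBipartiteGraph {q : ℕ} (hq : Odd q) (h5 : 5 ≤ q) :
    P1Win (completeBipartiteGraph (Fin 3) (Fin q)) := by
  obtain ⟨k, rfl⟩ : ∃ k, q = 2 * k + 5 := by
    obtain ⟨j, rfl⟩ := hq
    exact ⟨j - 2, by omega⟩
  have h₀ := counts_univ (B := Fin (2 * k + 5))
  rw [Fintype.card_fin] at h₀
  refine p1Win_of_posWin 0 (fun l b hl => posWin_in_phase (k + 2) _ _ _ _ _ _ h₀ rfl hl)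
    fun l b hl => ?_
  rcases eq_or_ne b 0 with rfl | hb
  · rw [take_self, Finset.mem_erase] at hl
    have hk : take (take (fun _ => Finset.univ) 0 0) l 0 (0 : Fin (2 * k + 5)) = {-(0 + l)} := by
      rw [take_self, take_self, univ_erase_erase hl.1]
    refine .oneRight _ _ _ (-(0 + l)) (by rw [hk]; exact Finset.mem_singleton_self _)
      (good_start_same k hl.1 _ ?_)
    convert h₀.update_empty (b := 0) rfl using 1
    swap
    · omega
    rw [take, hk, Finset.erase_singleton, take, take, Function.update_idem, Function.update_idem]
  · obtain ⟨u, hu, hg⟩ := good_start_fresh (B := Fin (2 * k + 5)) k l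
    refine .oneRight _ _ _ u ?_ (hg _ ?_)
    · rw [take_of_ne _ _ hb.symm, take_self]
      simp [hu]
    · have := (h₀.update_compl (b := b) rfl l).update_fresh (b := 0)
        (by rw [Function.update_of_ne hb.symm]) (-(0 + u))
      convert this using 1
      · rw [← univ_erase_erase hu]
        funext a
        rcases eq_or_ne a 0 with rfl | ha
        · simp [take, hb.symm]
        · rcases eq_or_ne a b with rfl | hab
          · simp [take, ha, Finset.compl_singleton]
          · simp [take, ha, hab]
      · omega
      · exact (zero_add _).symm

end

end TrailTrap

theorem mainTheorem3 :
    (∀ p q : ℕ, Even p ∨ Even q →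
      TrailTrap.P2Win (completeBipartiteGraph (Fin p) (Fin q))) ∧
    (∀ q : ℕ, Odd q → 5 ≤ q →
      TrailTrap.P1Win (completeBipartiteGraph (Fin 3) (Fin q))) := by
  exact ⟨fun _ _ h => TrailTrap.p2Win_completeBipartiteGraph h,
    fun _ hq h5 => TrailTrap.p1Win_completeBipartiteGraph hq h5⟩
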